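/- Let $n\ge 1$ be an integer and write $[n]_q=1+q+\cdots+q^{n-1}$ and $[n]_{q^{-1}}=1+q^{-1}+\cdots+q^{-(n-1)}$. The 2-periodic continued fraction $$\Phi_n(q)=[n]_q+\cfrac{q^n}{[n]_{q^{-1}}+\cfrac{q^{-n}}{[n]_q+\cfrac{q^n}{[n]_{q^{-1}}+\cfrac{q^{-n}}{[n]_q+\ddots}}}}$$ converges in the field $\mathbb{Q}((q))$ of formal Laurent series (for the $q$-adic topology), and its limit is a power series $\Phi_n(q)=\sum_{i\ge 0} f_i q^i$ with integer coefficients; $\Phi_n$ is the $q$-deformation, in the sense of Morier-Genoud and Ovsienko, of the metallic number $(n+\sqrt{n^2+4})/2$. For $\ell,j\ge 0$ let $$\Delta^{(\ell)}_j=\det\bigl(f_{\ell+a+b}\bigr)_{0\le a,b\le j-1},\qquad \Delta^{(\ell)}_0=1,$$ be the shifted Hankel determinants of $\Phi_n$. Then for every $\ell\in\{0,1,\ldots,n+1\}$: 1. $\Delta^{(\ell)}_j\in\{-1,0,1\}$ for all $j\ge 0$; 2. $\Delta^{(\ell)}_{j+2n(n+1)}=(-1)^n\,\Delta^{(\ell)}_j$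 for all $j\ge 0$. That is, the sequence $(\Delta^{(\ell)}_j)_{j\ge 0}$ is $2n(n+1)$-periodic when $n$ is even, and $2n(n+1)$-antiperiodic (hence $4n(n+1)$-periodic) when $n$ is odd. -/

import Mathlib

open Filter Topology
open scoped LaurentSeries PowerSeries

noncomputable section

/-- The `q`-integer `[n]_q = 1 + q + ⋯ + q ^ (n - 1)`, at an element `q` of a semiring. -/
def qInt {K : Type*} [Semiring K] (q : K) (n : ℕ) : K :=
  ∑ i ∈ Finset.range n, q ^ i

/-- The indeterminate `q` of the field `ℚ((q))` of formal Laurent series. -/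
def qVar : ℚ⸨X⸩ := HahnSeries.single 1 1

/-- The `2`-periodic continued fraction
`[n]_q + q^n / ([n]_{q⁻¹} + q^{-n} / ([n]_q + q^n / ([n]_{q⁻¹} + ⋯)))` over `ℚ((q))`. -/
def metallicCF (n : ℕ) : GenContFract ℚ⸨X⸩ where
  h := qInt qVar n
  s := Stream'.Seq.ofStream fun i =>
    if Even i then ⟨qVar ^ n, qInt qVar⁻¹ n⟩ else ⟨qVar⁻¹ ^ n, qInt qVar n⟩

/-- The `q`-metallic number `Φ_n`: the limit of the convergents of `metallicCF n` in the
`q`-adic topology of `ℚ((q))`. -/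
def qMetallic (n : ℕ) : ℚ⸨X⸩ :=
  limUnder atTop (metallicCF n).convs

/-- The Hankel determinant of size `j` and shift `ℓ` of a sequence `f`,
`det (f (ℓ + a + b))` for `0 ≤ a, b < j`; it is `1` for `j = 0`. -/
def hankelDet {R : Type*} [CommRing R] (f : ℕ → R) (ℓ j : ℕ) : R :=
  (Matrix.of fun a b : Fin j => f (ℓ + a + b)).det

/-- The Hankel determinant of size `j` and shift `ℓ` of the Taylor coefficients of `Φ_n`. -/
def metallicHankel (n ℓ j : ℕ) : ℚ :=
  hankelDet (fun i => (qMetallic n).coeff (i : ℤ)) ℓ j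

end

/-! Put G = q^n Φ_n and let H_L(j) be its Hankel determinant of size j and shift L, so that
Δ^{(ℓ)}_j = H_{n+ℓ}(j) and only shifts L ≤ 2n+1 occur. Padding by q^n makes the shifts close into a
cycle: H_L(n+1+j) = (-1)^j H_L(n+1) H_{L+1}(j) for L ≤ 2n (`hankelDet_step`), and H_{2n} = H_0
(`hankelDet_two_mul`). Both follow from `hankelDet_add_of_transfer`, a block triangularisation by
polynomials built from truncations of q^t Φ_n; the functional equations of Φ_n express the products
with G through the truncation errors, which are again shifts of G.

The coefficients of G in degrees 0, …, 3n are n zeros, n ones, n zeros and a one. Hence H_L(j) is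
-1, 0 or 1 for j ≤ n (interval matrices), while H_L(n+1) = ±1 and H_i(n+1) = (-1)^n H_{n+i}(n+1) for
i < n. The recurrence gives all values by induction on j. Applied 2n times from L = 0 it returns to
H_0, with total sign ∏_{i<2n} H_i(n+1) = (-1)^{n·n} = (-1)^n; cancelling units carries this to every
shift.

Convergence is separate: the error p - Φ_n q of a convergent p/q, with powers of the indeterminate
cleared, gains over each period a factor divisible by the indeterminate. -/

/-! ### Determinant identities. -/

open PowerSeries in
/-- If `Q t`, for `t < j`, are polynomials of degree `< d + j` with lowest term `X ^ t`, such that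
the middle coefficients of `Q t * G` vanish at first and then agree, up to a constant and a
unipotent transformation, with those of `X ^ t * G'`, then the Hankel determinants of `G` and `G'`
are proportional. -/
theorem hankelDet_add_of_transfer {A : Type*} [CommRing A] (G G' V : A⟦X⟧) (L L' d j : ℕ) (c : A)
    (hV : constantCoeff V = 1) (Q h : ℕ → A⟦X⟧)
    (hdeg : ∀ t < j, ∀ m, d + j ≤ m → coeff m (Q t) = 0)
    (hlow : ∀ t < j, ∀ m < t, coeff m (Q t) = 0) (hone : ∀ t < j, coeff t (Q t) = 1)
    (hh : ∀ t < j, ∀ a < j, coeff a (h t) = coeff (L' + (j - 1 - t) + a) G')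
    (hQ : ∀ t < j, ∀ a < d + j,
      coeff (L + (d + j - 1) + a) (Q t * G) = c * coeff a (X ^ d * (V * h t))) :
    hankelDet (fun i => coeff i G) L (d + j) =
      c ^ j * hankelDet (fun i => coeff i G) L d * hankelDet (fun i => coeff i G') L' j := by
  have key : ∀ t < j, ∀ a < d + j, ∑ b ∈ Finset.range (d + j),
      coeff (L + a + b) G * coeff (d + j - 1 - b) (Q t) = c * coeff a (X ^ d * (V * h t)) := by
    intro t ht a ha
    rw [← hQ t ht a ha, coeff_mul, Finset.Nat.sum_antidiagonal_eq_sum_range_succ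
      (fun x y => coeff x (Q t) * coeff y G), ← Finset.sum_range_reflect,
      ← Finset.sum_subset (Finset.range_mono (show d + j ≤ L + (d + j - 1) + a + 1 by omega))]
    · refine Finset.sum_congr rfl fun b hb => ?_
      rw [Finset.mem_range] at hb
      rw [mul_comm]
      congr 3 <;> omega
    · intro x _ hx
      rw [Finset.mem_range] at hx
      rw [hdeg t ht x (by omega), zero_mul]
  let e : Fin d ⊕ Fin j ≃ Fin (d + j) := finSumFinEquiv
  let H : Matrix (Fin (d + j)) (Fin (d + j)) A := Matrix.of fun a b => coeff (L + a + b) G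
  let M : Matrix (Fin (d + j)) (Fin j) A :=
    Matrix.of fun b t => coeff (d + j - 1 - b) (Q (j - 1 - t))
  let C : Matrix (Fin d) (Fin d) A := Matrix.of fun a b => coeff (L + a + b) G
  let H' : Matrix (Fin j) (Fin j) A := Matrix.of fun a b => coeff (L' + a + b) G'
  let T : Matrix (Fin j) (Fin j) A :=
    Matrix.of fun a s => if (s : ℕ) ≤ a then coeff ((a : ℕ) - s) V else 0
  let M1 : Matrix (Fin d) (Fin j) A := M.submatrix (fun x => e (Sum.inl x)) id
  let M2 : Matrix (Fin j) (Fin j) A := M.submatrix (fun x => e (Sum.inr x)) id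
  let H1 : Matrix (Fin j) (Fin d) A := H.submatrix (fun x => e (Sum.inr x)) fun x => e (Sum.inl x)
  have hM : ∀ a t, (H * M) a t = c * coeff (a : ℕ) (X ^ d * (V * h (j - 1 - t))) := by
    intro a t
    rw [Matrix.mul_apply, ← key (j - 1 - t) (by omega) a a.2,
      Finset.sum_range fun b =>
        coeff (L + a + b) G * coeff (d + j - 1 - b) (Q (j - 1 - t))]
    rfl
  -- The columns of `M` are the reversed coefficients of the `Q t`, completed by d unit vectors. In
  -- the product, the factor `X ^ d` kills the upper right block, and multiplication by `V` becomes
  -- the unipotent Toeplitz matrix `T` in the lower right one.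
  have hprod : H.submatrix e e * Matrix.fromBlocks (1 : Matrix (Fin d) (Fin d) A) M1 0 M2 =
      Matrix.fromBlocks C 0 H1 (c • (T * H')) := by
    have hcol : ∀ (x : Fin d ⊕ Fin j) (t : Fin j),
        (H.submatrix e e * Matrix.fromBlocks (1 : Matrix (Fin d) (Fin d) A) M1 0 M2) x (Sum.inr t) =
          (H * M) (e x) t := by
      intro x t
      rw [Matrix.mul_apply, Matrix.mul_apply, ← e.sum_comp, Fintype.sum_sum_type,
        Fintype.sum_sum_type]
      rfl
    have hcol' : ∀ (x : Fin d ⊕ Fin j) (t : Fin d),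
        (H.submatrix e e * Matrix.fromBlocks (1 : Matrix (Fin d) (Fin d) A) M1 0 M2) x (Sum.inl t) =
          H (e x) (e (Sum.inl t)) := by
      intro x t
      rw [Matrix.mul_apply, Fintype.sum_sum_type]
      simp [Matrix.one_apply]
    ext x y
    rcases y with y | y
    · rw [hcol']
      rcases x with x | x
      · simp [H, C, e]
      · rfl
    · rw [hcol, hM]
      rcases x with x | x
      · have : ((e (Sum.inl x) : Fin (d + j)) : ℕ) = x := by simp [e]
        rw [this, coeff_X_pow_mul']
        simp
      · have : ((e (Sum.inr x) : Fin (d + j)) : ℕ) = x + d := by simp [e, add_comm]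
        rw [this, coeff_X_pow_mul, mul_comm V, coeff_mul,
          Finset.Nat.sum_antidiagonal_eq_sum_range_succ
            (fun p q => coeff p (h (j - 1 - y)) * coeff q V)]
        simp only [Matrix.fromBlocks_apply₂₂, Matrix.smul_apply, Matrix.mul_apply, smul_eq_mul]
        congr 1
        let f : ℕ → A := fun s =>
          if s ≤ (x : ℕ) then coeff ((x : ℕ) - s) V * coeff (L' + s + y) G' else 0
        have hf : ∑ s : Fin j, T x s * H' s y = ∑ s ∈ Finset.range ((x : ℕ) + 1), f s := by
          rw [Finset.sum_subset (Finset.range_mono (show (x : ℕ) + 1 ≤ j by omega)),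
            Finset.sum_range]
          · refine Finset.sum_congr rfl fun s _ => ?_
            simp only [T, H', f, Matrix.of_apply, ite_mul, zero_mul]
          · intro s _ hs
            rw [Finset.mem_range] at hs
            exact if_neg (by omega)
        rw [hf]
        refine Finset.sum_congr rfl fun s hs => ?_
        rw [Finset.mem_range] at hs
        simp only [f]
        rw [if_pos (by omega), hh _ (by omega) _ (by omega), mul_comm]
        congr 3
        omega
  have hM2 : M2.det = 1 := by
    rw [Matrix.det_of_isUpperTriangular]
    · refine Finset.prod_eq_one fun i _ => ?_
      have : d + j - 1 - (d + (i : ℕ)) = j - 1 - i := by omega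
      simp only [M2, M, e, Matrix.submatrix_apply, Matrix.of_apply, finSumFinEquiv_apply_right,
        Fin.val_natAdd, id, this]
      exact hone _ (by omega)
    · intro a b hab
      have hab' : (b : ℕ) < a := hab
      simp only [M2, M, e, Matrix.submatrix_apply, Matrix.of_apply, finSumFinEquiv_apply_right,
        Fin.val_natAdd, id]
      exact hlow _ (by omega) _ (by omega)
  have hT : T.det = 1 := by
    rw [Matrix.det_of_isLowerTriangular]
    · refine Finset.prod_eq_one fun i _ => ?_
      simp [T, hV]
    · intro a b hab
      have hab' : (a : ℕ) < b := hab
      simp only [T, Matrix.of_apply]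
      rw [if_neg (by omega)]
  have := congrArg Matrix.det hprod
  rw [Matrix.det_mul, Matrix.det_submatrix_equiv_self, Matrix.det_fromBlocks_zero₂₁,
    Matrix.det_fromBlocks_zero₁₂, Matrix.det_smul, Matrix.det_mul, hM2, hT, Matrix.det_one] at this
  simp only [mul_one, one_mul, Fintype.card_fin] at this
  rw [hankelDet, hankelDet, hankelDet]
  change H.det = c ^ j * C.det * H'.det
  rw [this]
  ring

/-- A square matrix whose rows are indicator functions of intervals has determinant
`-1`, `0` or `1`. -/
theorem det_interval_matrix (j : ℕ) (lo hi : Fin j → ℕ) :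
    (Matrix.of fun a b : Fin j => if lo a ≤ b ∧ (b : ℕ) < hi a then (1 : ℤ) else 0).det ∈
      ({-1, 0, 1} : Set ℤ) := by
  induction j with
  | zero => simp
  | succ j ih =>
    classical
    let S : Finset (Fin (j + 1)) := Finset.univ.filter fun a => lo a = 0 ∧ 0 < hi a
    by_cases hS : S.Nonempty
    -- Subtract the shortest row meeting column 0 from the others that meet it: they remain
    -- intervals, now starting at `hi i`, and column 0 keeps a single 1.
    · obtain ⟨i, hiS, hmin⟩ := S.exists_min_image hi hS
      simp only [S, Finset.mem_filter, Finset.mem_univ, true_and] at hiS hmin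
      let lo' : Fin (j + 1) → ℕ := fun a => if a ≠ i ∧ lo a = 0 ∧ 0 < hi a then hi i else lo a
      rw [Matrix.det_eq_of_forall_row_eq_smul_add_const
        (B := Matrix.of fun a b : Fin (j + 1) =>
          if lo' a ≤ b ∧ (b : ℕ) < hi a then (1 : ℤ) else 0)
        (fun a => if a ≠ i ∧ lo a = 0 ∧ 0 < hi a then 1 else 0) i (by simp)]
      · rw [Matrix.det_succ_column_zero, Finset.sum_eq_single i]
        · have h1 : (Matrix.of fun a b : Fin (j + 1) =>
              if lo' a ≤ b ∧ (b : ℕ) < hi a then (1 : ℤ) else 0) i 0 = 1 := by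
            simp [lo', hiS]
          have h2 : (Matrix.of fun a b : Fin (j + 1) =>
              if lo' a ≤ b ∧ (b : ℕ) < hi a then (1 : ℤ) else 0).submatrix i.succAbove Fin.succ =
              Matrix.of fun a b : Fin j =>
                if lo' (i.succAbove a) - 1 ≤ b ∧ (b : ℕ) < hi (i.succAbove a) - 1
                  then (1 : ℤ) else 0 := by
            ext a b
            simp only [Matrix.submatrix_apply, Matrix.of_apply, Fin.val_succ]
            congr 1
            apply propext
            omega
          rw [h1, h2]
          rcases ih (fun a => lo' (i.succAbove a) - 1) (fun a => hi (i.succAbove a) - 1)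
            with h | h | h <;> rw [h] <;>
          rcases neg_one_pow_eq_or ℤ (i : ℕ) with h' | h' <;> rw [h'] <;> simp
        · intro a _ ha
          have : (Matrix.of fun a b : Fin (j + 1) =>
              if lo' a ≤ b ∧ (b : ℕ) < hi a then (1 : ℤ) else 0) a 0 = 0 := by
            simp only [lo', Matrix.of_apply, Fin.val_zero]
            refine if_neg fun h => ?_
            split_ifs at h with h' <;> omega
          rw [this]
          simp
        · simp
      · intro a b
        have hmin' := hmin a
        simp only [Matrix.of_apply, lo']
        by_cases h : a ≠ i ∧ lo a = 0 ∧ 0 < hi a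
        · have := hmin' h.2
          simp only [if_pos h, ne_eq, not_true_eq_false, false_and, if_false]
          split_ifs <;> omega
        · simp [if_neg h]
    · have : (Matrix.of fun a b : Fin (j + 1) =>
          if lo a ≤ b ∧ (b : ℕ) < hi a then (1 : ℤ) else 0).det = 0 := by
        refine Matrix.det_eq_zero_of_column_eq_zero 0 fun a => ?_
        have : a ∉ S := fun h => hS ⟨a, h⟩
        simp only [S, Finset.mem_filter, Finset.mem_univ, true_and] at this
        simp only [Matrix.of_apply, Fin.val_zero]
        exact if_neg (by omega)
      rw [this]
      simp

/-- Two integer matrices whose upper rows are initial segments of lengths `k, …, 1`, and whose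
lower rows start with a `1` in columns `m, m - 1, …, k`, have the same determinant `±1`. -/
theorem det_prefix_suffix (m k : ℕ) (hk : k ≤ m + 1) : ∃ s : ℤ, s ^ 2 = 1 ∧
    ∀ N : Matrix (Fin (m + 1)) (Fin (m + 1)) ℤ,
      (∀ a b : Fin (m + 1), (a : ℕ) < k → N a b = if (a : ℕ) + b < k then 1 else 0) →
      (∀ a b : Fin (m + 1), k ≤ (a : ℕ) → (a : ℕ) + b < m + k → N a b = 0) →
      (∀ a b : Fin (m + 1), k ≤ (a : ℕ) → (a : ℕ) + b = m + k → N a b = 1) → N.det = s := by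
  -- Reversing the first k rows and the columns from k on makes every such matrix lower triangular
  -- with unit diagonal, so s is the product of the two signs.
  let r : Fin (m + 1) → Fin (m + 1) := fun a =>
    if h : (a : ℕ) < k then ⟨k - 1 - a, by omega⟩ else a
  let t : Fin (m + 1) → Fin (m + 1) := fun b =>
    if h : (b : ℕ) < k then b else ⟨m + k - b, by omega⟩
  have hr : Function.Involutive r := by
    intro a
    ext
    simp only [r]
    split_ifs <;> simp_all <;> omega
  have ht : Function.Involutive t := by
    intro a
    ext
    simp only [t]
    split_ifs <;> simp_all <;> omega
  refine ⟨Equiv.Perm.sign hr.toPerm * Equiv.Perm.sign ht.toPerm, ?_, fun N h1 h2 h3 => ?_⟩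
  · rw [mul_pow]
    norm_cast
    simp
  · have hdet : ((N.submatrix id ht.toPerm).submatrix hr.toPerm id).det = 1 := by
      rw [Matrix.det_of_isLowerTriangular]
      · refine Finset.prod_eq_one fun a _ => ?_
        simp only [Matrix.submatrix_apply, Function.Involutive.coe_toPerm, id, r, t]
        split_ifs with h
        · rw [h1 _ _ (by dsimp only; omega), if_pos (by dsimp only; omega)]
        · exact h3 _ _ (by omega) (by dsimp only; omega)
      · intro a b hab
        have hab' : (a : ℕ) < b := hab
        simp only [Matrix.submatrix_apply, Function.Involutive.coe_toPerm, id, r, t]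
        split_ifs
        · rw [h1 _ _ (by dsimp only; omega), if_neg (by dsimp only; omega)]
        · rw [h1 _ _ (by dsimp only; omega), if_neg (by dsimp only; omega)]
        · omega
        · exact h2 _ _ (by omega) (by dsimp only; omega)
    rw [Matrix.det_permute, Matrix.det_permute'] at hdet
    have e1 : ((Equiv.Perm.sign hr.toPerm : ℤˣ) : ℤ) ^ 2 = 1 := by norm_cast; simp
    have e2 : ((Equiv.Perm.sign ht.toPerm : ℤˣ) : ℤ) ^ 2 = 1 := by norm_cast; simp
    push_cast at hdet
    linear_combination (-(N.det) * ((Equiv.Perm.sign ht.toPerm : ℤˣ) : ℤ) ^ 2) * e1 - N.det * e2 +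
      (((Equiv.Perm.sign hr.toPerm : ℤˣ) : ℤ) * ((Equiv.Perm.sign ht.toPerm : ℤˣ) : ℤ)) * hdet

/-! ### The power series expansion of the q-metallic number. -/

namespace PowerSeries

theorem coeff_coe_eq_zero_of_natDegree_lt {A : Type*} [CommRing A] (p : Polynomial A) {m : ℕ}
    (h : p.natDegree < m) : coeff m (p : A⟦X⟧) = 0 := by
  rw [Polynomial.coeff_coe, Polynomial.coeff_eq_zero_of_natDegree_lt h]

theorem natDegree_trunc_le {A : Type*} [CommRing A] (N : ℕ) (f : A⟦X⟧) :
    (trunc N f).natDegree ≤ N - 1 := by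
  cases N with
  | zero => simp
  | succ N => exact Nat.le_of_lt_succ (natDegree_trunc_lt f N)

theorem coe_qInt_X {A : Type*} [CommRing A] (n : ℕ) :
    ((qInt (Polynomial.X : Polynomial A) n : Polynomial A) : A⟦X⟧) = qInt X n := by
  simp only [qInt, ← Polynomial.coeToPowerSeries.ringHom_apply, map_sum, map_pow]
  simp [Polynomial.coeToPowerSeries.ringHom_apply]

theorem natDegree_qInt_X_le {A : Type*} [CommRing A] (n : ℕ) :
    (qInt (Polynomial.X : Polynomial A) n).natDegree ≤ n - 1 := by
  refine Polynomial.natDegree_sum_le_of_forall_le _ _ fun i hi => ?_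
  rw [Finset.mem_range] at hi
  exact (Polynomial.natDegree_X_pow_le i).trans (by omega)

theorem coeff_qInt_X {A : Type*} [CommRing A] (n m : ℕ) :
    coeff m (qInt (X : A⟦X⟧) n) = if m < n then 1 else 0 := by
  simp [qInt, coeff_X_pow]

theorem one_sub_X_mul_qInt {A : Type*} [CommRing A] (n : ℕ) :
    (1 - X) * qInt (X : A⟦X⟧) n = 1 - X ^ n := by
  rw [qInt, mul_comm, ← neg_sub, mul_neg, geom_sum_mul]
  ring

/-- The data of the power series expansion `F` of the `q`-metallic number: its quadratic equation,
and the tail `V` of its expansion `F = [n]_q + q ^ (2 * n) * V`. -/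
structure IsMetallic {A : Type*} [CommRing A] (n : ℕ) (F V : A⟦X⟧) : Prop where
  quadratic : X * F ^ 2 + ((1 - X) * (1 + X ^ n) - X * qInt X n) * F = 1
  eq_add : F = qInt X n + X ^ (2 * n) * V
  tail_mul : V * (1 + X * qInt X n * F) = F
  constantCoeff_eq_one : constantCoeff F = 1

/-- With P the linear coefficient and W = 1/P, the equation X F² + P F = 1 is solved integrally by F
= W g, where g is the Catalan series evaluated at -X W². One period of the continued fraction reads
F = [n] + X^{2n} F / (1 + X [n] F), because [n]_{q⁻¹} = q^{1-n} [n]_q; this is [n] times the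
quadratic equation, and it dictates V. -/
theorem exists_isMetallic {n : ℕ} (hn : 1 ≤ n) : ∃ F V : ℤ⟦X⟧, IsMetallic n F V := by
  set P : ℤ⟦X⟧ := (1 - X) * (1 + X ^ n) - X * qInt X n with hP
  have hn0 : n ≠ 0 := by omega
  have hP1 : constantCoeff P = 1 := by simp [hP, hn0]
  obtain ⟨W, hW⟩ : ∃ W, P * W = 1 := ⟨invOfUnit P 1, mul_invOfUnit P 1 (by simp [hP1])⟩
  have hs : HasSubst (-X * W ^ 2 : ℤ⟦X⟧) := HasSubst.of_constantCoeff_zero' (by simp)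
  obtain ⟨g, hg⟩ : ∃ g : ℤ⟦X⟧, g ^ 2 * (-X * W ^ 2) + 1 = g := by
    have h := congrArg (fun f : ℕ⟦X⟧ => substAlgHom hs (map (Nat.castRingHom ℤ) f))
      catalanSeries_sq_mul_X_add_one
    simp only [map_add, map_mul, map_pow, map_one, map_X, substAlgHom_X] at h
    exact ⟨_, h⟩
  set F := W * g with hFdef
  have hF : X * F ^ 2 + P * F = 1 := by
    rw [hFdef]
    linear_combination g * hW - hg
  have hF1 : constantCoeff F = 1 := by
    have := congrArg constantCoeff hF
    simpa [hP1] using this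
  set a : ℤ⟦X⟧ := qInt X n with ha
  have hu : constantCoeff (1 + X * a * F) = 1 := by simp
  obtain ⟨Y, hY⟩ : ∃ Y, (1 + X * a * F) * Y = 1 :=
    ⟨invOfUnit _ 1, mul_invOfUnit _ 1 (by simp)⟩
  have hgeo : (1 - X) * a = 1 - X ^ n := one_sub_X_mul_qInt n
  refine ⟨F, F * Y, hF, ?_, ?_, hF1⟩
  · have h2 : (F - a) * (1 + X * a * F) = X ^ (2 * n) * F := by
      rw [hP] at hF
      linear_combination a * hF - (1 + X ^ n) * F * hgeo
    linear_combination (-F + a) * hY + Y * h2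
  · linear_combination F * hY

variable {A : Type*} [CommRing A] {n : ℕ} {F V : A⟦X⟧}

namespace IsMetallic

theorem constantCoeff_tail (h : IsMetallic n F V) : constantCoeff V = 1 := by
  have := congrArg constantCoeff h.tail_mul
  simpa [h.constantCoeff_eq_one] using this

/-- The sequence of coefficients of `q ^ n * Φ_n`. -/
theorem coeff_eq_ite (h : IsMetallic n F V) {m : ℕ} (hm : m ≤ 3 * n) :
    coeff m (X ^ n * F) = if n ≤ m ∧ m < 2 * n ∨ m = 3 * n then 1 else 0 := by
  rw [coeff_X_pow_mul']
  by_cases h0 : n ≤ m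
  · rw [if_pos h0, h.eq_add, map_add, coeff_qInt_X, coeff_X_pow_mul']
    by_cases h1 : m < 2 * n
    · rw [if_pos (by omega), if_neg (by omega), if_pos (by omega), add_zero]
    · rw [if_neg (by omega), zero_add]
      by_cases h2 : m = 3 * n
      · rw [if_pos (by omega), if_pos (by omega), show m - n - 2 * n = 0 by omega,
          coeff_zero_eq_constantCoeff_apply, h.constantCoeff_tail]
      · rw [if_neg (by omega), if_neg (by omega)]
  · rw [if_neg h0, if_neg (by omega)]

/-! ### The two recurrences between Hankel determinants. -/

/-- The truncation error is a shift of `X ^ n * F`. The truncated subtraction is harmless: for K < n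
the missing coefficients are those of the padding, which vanish. -/
theorem X_pow_mul_sub_trunc (n K N t : ℕ) (F : A⟦X⟧) (hKN : K - n = N) :
    X ^ n * (X ^ t * F - ((trunc N (X ^ t * F) : Polynomial A) : A⟦X⟧)) =
      X ^ K * PowerSeries.mk fun a => coeff (K + a) (X ^ n * (X ^ t * F)) := by
  subst hKN
  ext m
  rw [coeff_X_pow_mul', coeff_X_pow_mul', map_sub, Polynomial.coeff_coe, coeff_trunc]
  by_cases h1 : n ≤ m
  · rw [if_pos h1]
    by_cases h2 : K ≤ m
    · rw [if_pos h2, if_neg (by omega), coeff_mk, Nat.add_sub_cancel' h2,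
        coeff_X_pow_mul' (X ^ t * F), if_pos h1, sub_zero]
    · rw [if_pos (by omega), if_neg h2, sub_self]
  · rw [if_neg h1]
    split_ifs with h2
    · rw [coeff_mk, coeff_X_pow_mul', if_neg (by omega)]
    · rfl

/-- The quadratic equation reads R F + X F (F - [n]) = 1. Replacing one factor X^t F by its
truncation P_t shows that (R X^t + X P_t) X^n F is a polynomial of degree below L + n + j minus
X^{2n+1} V times the truncation error, whence c = -1. -/
theorem hankelDet_step (h : IsMetallic n F V) (hn : 1 ≤ n) {L : ℕ} (hL : L ≤ 2 * n) (j : ℕ) :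
    hankelDet (fun i => coeff i (X ^ n * F)) L (n + 1 + j) =
      (-1) ^ j * hankelDet (fun i => coeff i (X ^ n * F)) L (n + 1) *
        hankelDet (fun i => coeff i (X ^ n * F)) (L + 1) j := by
  let P : ℕ → Polynomial A := fun t => trunc (L + j - n) (X ^ t * F)
  let R : Polynomial A := (1 - Polynomial.X) * (1 + Polynomial.X ^ n)
  let a : Polynomial A := qInt Polynomial.X n
  let Q : ℕ → Polynomial A := fun t => R * Polynomial.X ^ t + Polynomial.X * P t
  let Q' : ℕ → Polynomial A := fun t =>
    Polynomial.X ^ n * (Polynomial.X ^ t + Polynomial.X * a * P t)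
  let g : ℕ → A⟦X⟧ := fun t =>
    PowerSeries.mk fun a => coeff (L + j + a) (X ^ n * (X ^ t * F))
  have hP : ∀ t, P t = 0 ∨ (P t).natDegree + n + 1 ≤ L + j := by
    intro t
    by_cases hz : L + j ≤ n
    · left
      simp only [P, Nat.sub_eq_zero_of_le hz, trunc_zero']
    · right
      have := natDegree_trunc_le (L + j - n) (X ^ t * F)
      simp only [P]
      omega
  have hRdeg : R.natDegree ≤ n + 1 := by
    simp only [R]
    compute_degree
    omega
  have hadeg : a.natDegree ≤ n - 1 := natDegree_qInt_X_le n
  have hacoe : (a : A⟦X⟧) = qInt X n := coe_qInt_X n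
  refine hankelDet_add_of_transfer (X ^ n * F) (X ^ n * F) V L (L + 1) (n + 1) j (-1)
    h.constantCoeff_tail (fun t => (Q t : A⟦X⟧)) g ?_ ?_ ?_ ?_ ?_
  · intro t ht m hm
    refine coeff_coe_eq_zero_of_natDegree_lt _ (lt_of_le_of_lt ?_ (lt_of_lt_of_le
      (show n + j < n + 1 + j by omega) hm))
    refine Polynomial.natDegree_add_le_of_degree_le ?_ ?_
    · refine Polynomial.natDegree_mul_le.trans ?_
      have := Polynomial.natDegree_X_pow_le (R := A) t
      omega
    -- The degree of X P_t is at most L + j - n, and L ≤ 2n brings it down to n + j.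
    · rcases hP t with h0 | h0
      · simp [h0]
      · refine Polynomial.natDegree_mul_le.trans ?_
        have := Polynomial.natDegree_X_le (R := A)
        omega
  · intro t ht m hm
    simp only [Q, R, P, Polynomial.coe_add, Polynomial.coe_mul, Polynomial.coe_pow,
      Polynomial.coe_X, map_add]
    rw [mul_comm, coeff_X_pow_mul', if_neg (by omega), zero_add]
    cases m with
    | zero => simp
    | succ m =>
      rw [coeff_succ_X_mul, Polynomial.coeff_coe, coeff_trunc, coeff_X_pow_mul']
      split_ifs <;> first | rfl | omega
  · intro t ht
    simp only [Q, R, P, Polynomial.coe_add, Polynomial.coe_mul, Polynomial.coe_pow,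
      Polynomial.coe_X, map_add]
    rw [mul_comm, coeff_X_pow_mul', if_pos le_rfl, Nat.sub_self]
    have : coeff t (X * ((trunc (L + j - n) (X ^ t * F) : Polynomial A) : A⟦X⟧)) = 0 := by
      cases t with
      | zero => simp
      | succ t =>
        rw [coeff_succ_X_mul, Polynomial.coeff_coe, coeff_trunc, coeff_X_pow_mul']
        split_ifs <;> first | rfl | omega
    rw [this, add_zero, coeff_zero_eq_constantCoeff_apply]
    simp [show n ≠ 0 by omega]
  · intro t ht b hb
    simp only [g, coeff_mk]
    rw [show X ^ n * (X ^ t * F) = X ^ t * (X ^ n * F) by ring, coeff_X_pow_mul',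
      if_pos (by omega)]
    congr 2
    omega
  · intro t ht b hb
    have hg : X ^ n * (X ^ t * F - (P t : A⟦X⟧)) = X ^ (L + j) * g t :=
      X_pow_mul_sub_trunc n (L + j) (L + j - n) t F rfl
    have hmain : (Q t : A⟦X⟧) * (X ^ n * F) =
        (Q' t : A⟦X⟧) - X ^ (L + j + n) * (X ^ (n + 1) * (V * g t)) := by
      have e1 : (Q t : A⟦X⟧) = (1 - X) * (1 + X ^ n) * X ^ t + X * (P t : A⟦X⟧) := by
        simp [Q, R]
      have e2 : (Q' t : A⟦X⟧) = X ^ n * (X ^ t + X * qInt X n * (P t : A⟦X⟧)) := by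
        simp [Q', hacoe]
      rw [e1, e2]
      linear_combination X ^ n * X ^ t * h.quadratic -
        X ^ (n + 1) * (X ^ t * F - (P t : A⟦X⟧)) * h.eq_add - X ^ (2 * n + 1) * V * hg
    have hQ'deg : (Q' t).natDegree < L + (n + 1 + j - 1) + b := by
      refine lt_of_le_of_lt (Polynomial.natDegree_mul_le_of_le
        (Polynomial.natDegree_X_pow_le n) (?_ : _ ≤ L + j - 1)) (by omega)
      refine Polynomial.natDegree_add_le_of_degree_le ?_ ?_
      · exact (Polynomial.natDegree_X_pow_le t).trans (by omega)
      · rcases hP t with h0 | h0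
        · simp [h0]
        · refine Polynomial.natDegree_mul_le.trans ?_
          have := Polynomial.natDegree_X_le (R := A)
          have := Polynomial.natDegree_mul_le (p := Polynomial.X) (q := a)
          omega
    rw [hmain, map_sub, coeff_coe_eq_zero_of_natDegree_lt _ hQ'deg,
      show L + (n + 1 + j - 1) + b = b + (L + j + n) by omega, coeff_X_pow_mul]
    ring

/-- The transfer with d = 0: since V = F Y with Y = 1/(1 + X [n] F), multiplying V by X^t + X [n]
P_t gives P_t + Y (X^t F - P_t). -/
theorem hankelDet_two_mul (h : IsMetallic n F V) (hn : 1 ≤ n) (j : ℕ) :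
    hankelDet (fun i => coeff i (X ^ n * F)) (2 * n) j =
      hankelDet (fun i => coeff i (X ^ n * F)) 0 j := by
  obtain ⟨Y, hY⟩ : ∃ Y, (1 + X * qInt X n * F) * Y = 1 :=
    ⟨invOfUnit _ 1, mul_invOfUnit _ 1 (by simp)⟩
  have hY1 : constantCoeff Y = 1 := by
    have := congrArg constantCoeff hY
    simpa using this
  let P : ℕ → Polynomial A := fun t => trunc (j - 1 - n) (X ^ t * F)
  let a : Polynomial A := qInt Polynomial.X n
  let Q : ℕ → Polynomial A := fun t => Polynomial.X ^ t + Polynomial.X * a * P t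
  let Q' : ℕ → Polynomial A := fun t =>
    Q t * (Polynomial.X ^ n * a) + Polynomial.X ^ (3 * n) * P t
  let g : ℕ → A⟦X⟧ := fun t => PowerSeries.mk fun a => coeff (j - 1 + a) (X ^ n * (X ^ t * F))
  have hP : ∀ t, P t = 0 ∨ (P t).natDegree + n + 1 ≤ j - 1 := by
    intro t
    by_cases hz : j - 1 ≤ n
    · left
      simp only [P, Nat.sub_eq_zero_of_le hz, trunc_zero']
    · right
      have := natDegree_trunc_le (j - 1 - n) (X ^ t * F)
      simp only [P]
      omega
  have hadeg : a.natDegree ≤ n - 1 := natDegree_qInt_X_le n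
  have hacoe : (a : A⟦X⟧) = qInt X n := coe_qInt_X n
  have hQdeg : ∀ t < j, (Q t).natDegree ≤ j - 1 := by
    intro t ht
    refine Polynomial.natDegree_add_le_of_degree_le ?_ ?_
    · exact (Polynomial.natDegree_X_pow_le t).trans (by omega)
    · rcases hP t with h0 | h0
      · simp [h0]
      · refine Polynomial.natDegree_mul_le.trans ?_
        have := Polynomial.natDegree_X_le (R := A)
        have := Polynomial.natDegree_mul_le (p := Polynomial.X) (q := a)
        omega
  have hQcoe : ∀ t, (Q t : A⟦X⟧) = X ^ t + X * (qInt X n * (P t : A⟦X⟧)) := by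
    intro t
    simp [Q, hacoe, mul_assoc]
  have hlow : ∀ t m, m ≤ t → coeff m (X * (qInt X n * (P t : A⟦X⟧))) = 0 := by
    intro t m hm
    cases m with
    | zero => simp
    | succ m =>
      rw [coeff_succ_X_mul, coeff_mul]
      refine Finset.sum_eq_zero fun x hx => ?_
      rw [Finset.HasAntidiagonal.mem_antidiagonal] at hx
      rw [Polynomial.coeff_coe, coeff_trunc, coeff_X_pow_mul', if_neg (show ¬ t ≤ x.2 by omega),
        ite_self, mul_zero]
  have := hankelDet_add_of_transfer (X ^ n * F) (X ^ n * F) Y (2 * n) 0 0 j 1 hY1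
    (fun t => (Q t : A⟦X⟧)) g ?_ ?_ ?_ ?_ ?_
  · have h0 : hankelDet (fun i => coeff i (X ^ n * F)) (2 * n) 0 = 1 := Matrix.det_isEmpty
    rwa [h0, zero_add, one_pow, one_mul, one_mul] at this
  · intro t ht m hm
    exact coeff_coe_eq_zero_of_natDegree_lt _ (by have := hQdeg t ht; omega)
  · intro t ht m hm
    rw [hQcoe, map_add, hlow t m hm.le, coeff_X_pow, if_neg (by omega), add_zero]
  · intro t ht
    rw [hQcoe, map_add, hlow t t le_rfl, coeff_X_pow, if_pos rfl, add_zero]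
  · intro t ht b hb
    simp only [g, coeff_mk]
    rw [show X ^ n * (X ^ t * F) = X ^ t * (X ^ n * F) by ring, coeff_X_pow_mul',
      if_pos (by omega)]
    congr 2
    omega
  · intro t ht b hb
    have hg : X ^ n * (X ^ t * F - (P t : A⟦X⟧)) = X ^ (j - 1) * g t :=
      X_pow_mul_sub_trunc n (j - 1) (j - 1 - n) t F rfl
    have hmain : (Q t : A⟦X⟧) * (X ^ n * F) =
        (Q' t : A⟦X⟧) + X ^ (2 * n + (j - 1)) * (Y * g t) := by
      have e2 : (Q' t : A⟦X⟧) = (Q t : A⟦X⟧) * (X ^ n * qInt X n) + X ^ (3 * n) * (P t : A⟦X⟧) := by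
        simp [Q', hacoe]
      have hVY : V = F * Y := by linear_combination (-V) * hY + Y * h.tail_mul
      rw [e2, hQcoe]
      have e3 : X ^ (2 * n + (j - 1)) * (Y * g t) =
          X ^ (2 * n) * Y * (X ^ n * (X ^ t * F - (P t : A⟦X⟧))) := by
        rw [hg]; ring
      rw [e3]
      linear_combination (X ^ n * (X ^ t + X * (qInt X n * (P t : A⟦X⟧)))) * h.eq_add +
        X ^ (3 * n) * (X ^ t + X * (qInt X n * (P t : A⟦X⟧))) * hVY + X ^ (3 * n) * (P t : A⟦X⟧) * hY
    have hQ'deg : (Q' t).natDegree < 2 * n + (0 + j - 1) + b := by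
      refine lt_of_le_of_lt (?_ : _ ≤ 2 * n + j - 2) (by omega)
      refine Polynomial.natDegree_add_le_of_degree_le ?_ ?_
      · have := Polynomial.natDegree_mul_le_of_le
          (Polynomial.natDegree_X_pow_le (R := A) n) hadeg
        refine (Polynomial.natDegree_mul_le_of_le (hQdeg t ht) this).trans (by omega)
      · rcases hP t with h0 | h0
        · simp [h0]
        · refine Polynomial.natDegree_mul_le.trans ?_
          have := Polynomial.natDegree_X_pow_le (R := A) (3 * n)
          omega
    rw [hmain, map_add, coeff_coe_eq_zero_of_natDegree_lt _ hQ'deg,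
      show 2 * n + (0 + j - 1) + b = b + (2 * n + (j - 1)) by omega, coeff_X_pow_mul]
    simp

end IsMetallic

end PowerSeries

/-! ### Determinants of size at most n + 1, values and periodicity. -/

namespace PowerSeries.IsMetallic

variable {n : ℕ} {F V : ℤ⟦X⟧}

/-- Either the entries stop before the coefficient of degree 3n, so each row is an interval of ones,
or one row lies entirely in the zeros of degrees 2n to 3n - 1. -/
theorem hankelDet_mem_of_le (h : IsMetallic n F V) {L j : ℕ} (hL : L ≤ 2 * n) (hj : j ≤ n) :
    hankelDet (fun i => coeff i (X ^ n * F)) L j ∈ ({-1, 0, 1} : Set ℤ) := by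
  by_cases hc : j + L ≤ 2 * n ∨ L < n
  · have : hankelDet (fun i => coeff i (X ^ n * F)) L j = (Matrix.of fun a b : Fin j =>
        if n - L - a ≤ (b : ℕ) ∧ (b : ℕ) < 2 * n - L - a then (1 : ℤ) else 0).det := by
      rw [hankelDet]
      congr 1
      ext a b
      simp only [Matrix.of_apply]
      rw [h.coeff_eq_ite (by omega)]
      congr 1
      apply propext
      omega
    rw [this]
    exact det_interval_matrix j (fun a => n - L - a) (fun a => 2 * n - L - a)
  · have : hankelDet (fun i => coeff i (X ^ n * F)) L j = 0 := by
      refine Matrix.det_eq_zero_of_row_eq_zero ⟨2 * n - L, by omega⟩ fun b => ?_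
      simp only [Matrix.of_apply]
      rw [h.coeff_eq_ite (by omega), if_neg (by omega)]
    rw [this]
    simp

/-- Both matrices reduce to the shape of `det_prefix_suffix` with k = n - i, the one of shift n + i
directly. -/
theorem hankelDet_sq_and_eq (h : IsMetallic n F V) {i : ℕ} (hi : i < n) :
    hankelDet (fun i => coeff i (X ^ n * F)) (n + i) (n + 1) ^ 2 = 1 ∧
    hankelDet (fun i => coeff i (X ^ n * F)) i (n + 1) =
      (-1) ^ n * hankelDet (fun i => coeff i (X ^ n * F)) (n + i) (n + 1) := by
  obtain ⟨s, hs, hdet⟩ := det_prefix_suffix n (n - i) (by omega)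
  have h1 : hankelDet (fun i => coeff i (X ^ n * F)) (n + i) (n + 1) = s := by
    refine hdet _ ?_ ?_ ?_ <;> intro a b hab
    · simp only [Matrix.of_apply]
      rw [h.coeff_eq_ite (by omega)]
      congr 1
      apply propext
      omega
    · intro hb
      simp only [Matrix.of_apply]
      rw [h.coeff_eq_ite (by omega), if_neg (by omega)]
    · intro hb
      simp only [Matrix.of_apply]
      rw [h.coeff_eq_ite (by omega), if_pos (by omega)]
  rw [h1]
  refine ⟨hs, ?_⟩
  let H : Matrix (Fin (n + 1)) (Fin (n + 1)) ℤ :=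
    Matrix.of fun a b => coeff (i + a + b) (X ^ n * F)
  have hH : ∀ a b, H a b = if n - i ≤ (a : ℕ) + b ∧ (a : ℕ) + b < 2 * n - i then 1 else 0 := by
    intro a b
    simp only [H, Matrix.of_apply]
    rw [h.coeff_eq_ite (by omega)]
    congr 1
    apply propext
    omega
  have hlast : (0 : Fin (n + 1)) ≠ Fin.last n := by
    intro h0
    have := congrArg Fin.val h0
    simp at this
    omega
  -- For shift i the first and last rows are complementary. Negating the n - 1 middle rows and
  -- adding both extreme rows complements them; swapping the extreme rows then gives the required
  -- shape, with sign (-1)^{n-1} · (-1).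
  let c : Fin (n + 1) → ℤ := fun a => if a = 0 ∨ a = Fin.last n then 0 else 1
  let v : Fin (n + 1) → ℤ := fun a => if a = 0 ∨ a = Fin.last n then 1 else -1
  let W : Matrix (Fin (n + 1)) (Fin (n + 1)) ℤ := Matrix.of fun a b => v a * H a b
  let W₁ : Matrix (Fin (n + 1)) (Fin (n + 1)) ℤ := Matrix.of fun a b => W a b + c a * W 0 b
  let W₂ : Matrix (Fin (n + 1)) (Fin (n + 1)) ℤ :=
    Matrix.of fun a b => W₁ a b + c a * W₁ (Fin.last n) b
  have e0 : W.det = (∏ a, v a) * H.det := Matrix.det_mul_column v H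
  have e1 : W₁.det = W.det := by
    rw [Matrix.det_eq_of_forall_row_eq_smul_add_const c 0 (by simp [c]) (fun a b => ?_)]
    rfl
  have e2 : W₂.det = W₁.det := by
    rw [Matrix.det_eq_of_forall_row_eq_smul_add_const c (Fin.last n) (by simp [c]) (fun a b => ?_)]
    rfl
  have hv : ∏ a, v a = (-1) ^ (n - 1) := by
    obtain ⟨m, rfl⟩ : ∃ m, n = m + 1 := ⟨n - 1, by omega⟩
    rw [Fin.prod_univ_succ, Fin.prod_univ_castSucc]
    have : ∀ x : Fin m, v x.castSucc.succ = -1 := by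
      intro x
      refine if_neg ?_
      simp [Fin.ext_iff]
      omega
    simp only [this]
    simp [v]
  have e3 : (W₂.submatrix (Equiv.swap 0 (Fin.last n)) id).det = s := by
    have h00 : ∀ b, W₂ 0 b = H 0 b := by simp [W₂, W₁, W, c, v]
    have hll : ∀ b, W₂ (Fin.last n) b = H (Fin.last n) b := by simp [W₂, W₁, W, c, v]
    have haa : ∀ a, a ≠ 0 → a ≠ Fin.last n → ∀ b,
        W₂ a b = H 0 b + H (Fin.last n) b - H a b := by
      intro a h1 h2 b
      simp [W₂, W₁, W, c, v, h1, h2]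
      ring
    have hval : ∀ a b, (W₂.submatrix (Equiv.swap 0 (Fin.last n)) id) a b =
        if (a : ℕ) < n - i then (if (a : ℕ) + b < n - i then 1 else 0)
        else (if (a : ℕ) + b < n + (n - i) then 0 else 1) := by
      intro a b
      rw [Matrix.submatrix_apply, id]
      by_cases h0 : a = 0
      · subst h0
        rw [Equiv.swap_apply_left, hll, hH]
        simp only [Fin.val_last, Fin.val_zero]
        split_ifs <;> omega
      · by_cases hl : a = Fin.last n
        · subst hl
          rw [Equiv.swap_apply_right, h00, hH]
          simp only [Fin.val_last, Fin.val_zero]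
          split_ifs <;> omega
        · rw [Equiv.swap_apply_of_ne_of_ne h0 hl, haa a h0 hl, hH, hH, hH]
          have h0' : (a : ℕ) ≠ 0 := fun h => h0 (Fin.ext h)
          have hl' : (a : ℕ) ≠ n := fun h => hl (Fin.ext h)
          simp only [Fin.val_last, Fin.val_zero]
          split_ifs <;> omega
    refine hdet _ ?_ ?_ ?_ <;> intro a b hab
    · rw [hval, if_pos hab]
    · intro hb
      rw [hval, if_neg (by omega), if_pos hb]
    · intro hb
      rw [hval, if_neg (by omega), if_neg (by omega)]
  rw [Matrix.det_permute, Equiv.Perm.sign_swap hlast, e2, e1, e0, hv] at e3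
  change H.det = _
  have hpow : ((-1 : ℤ) ^ (n - 1)) * (-1) = (-1) ^ n := by
    rw [← pow_succ, Nat.sub_add_cancel (by omega)]
  have hsq : ((-1 : ℤ) ^ n) ^ 2 = 1 := by rw [← pow_mul, mul_comm, pow_mul]; simp
  push_cast at e3
  linear_combination (-1 : ℤ) ^ n * e3 - H.det * hsq - (-1 : ℤ) ^ n * H.det * hpow

theorem hankelDet_succ_sq (h : IsMetallic n F V) (hn : 1 ≤ n) {L : ℕ} (hL : L ≤ 2 * n) :
    hankelDet (fun i => coeff i (X ^ n * F)) L (n + 1) ^ 2 = 1 := by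
  have hsmall : ∀ i < n, hankelDet (fun i => coeff i (X ^ n * F)) i (n + 1) ^ 2 = 1 := by
    intro i hi
    obtain ⟨h1, h2⟩ := h.hankelDet_sq_and_eq hi
    rw [h2, mul_pow, h1, ← pow_mul, mul_comm n, pow_mul]
    simp
  by_cases h1 : L < n
  · exact hsmall L h1
  · by_cases h2 : L = 2 * n
    · rw [h2, h.hankelDet_two_mul hn]
      exact hsmall 0 (by omega)
    · obtain ⟨i, rfl⟩ := Nat.exists_eq_add_of_le (not_lt.mp h1)
      exact (h.hankelDet_sq_and_eq (by omega)).1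

/-- Compare the recurrence at shifts 2n and 0 and cancel the unit H_0(n+1). -/
theorem hankelDet_two_mul_add_one (h : IsMetallic n F V) (hn : 1 ≤ n) (j : ℕ) :
    hankelDet (fun i => coeff i (X ^ n * F)) (2 * n + 1) j =
      hankelDet (fun i => coeff i (X ^ n * F)) 1 j := by
  have h1 := h.hankelDet_step hn (L := 2 * n) le_rfl j
  have h2 := h.hankelDet_step hn (L := 0) (by omega) j
  rw [h.hankelDet_two_mul hn, h.hankelDet_two_mul hn, h2] at h1
  have hsq := h.hankelDet_succ_sq hn (L := 0) (by omega)
  refine (mul_left_cancel₀ (mul_ne_zero (pow_ne_zero j (by norm_num : (-1 : ℤ) ≠ 0)) ?_) h1).symm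
  intro h0
  rw [h0] at hsq
  norm_num at hsq

theorem hankelDet_mem (h : IsMetallic n F V) (hn : 1 ≤ n) (j : ℕ) :
    ∀ L ≤ 2 * n + 1,
      hankelDet (fun i => coeff i (X ^ n * F)) L j ∈ ({-1, 0, 1} : Set ℤ) := by
  induction j using Nat.strong_induction_on with
  | _ j ih =>
    have main : ∀ L < 2 * n,
        hankelDet (fun i => coeff i (X ^ n * F)) L j ∈ ({-1, 0, 1} : Set ℤ) := by
      intro L hL
      by_cases hj : j ≤ n
      · exact h.hankelDet_mem_of_le hL.le hj
      · obtain ⟨k, rfl⟩ := Nat.exists_eq_add_of_le (show n + 1 ≤ j by omega)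
        rw [h.hankelDet_step hn hL.le]
        rcases mul_self_eq_one_iff.mp ((sq _).symm.trans (h.hankelDet_succ_sq hn hL.le)) with h1 | h1 <;>
        rcases neg_one_pow_eq_or ℤ k with h2 | h2 <;>
        rcases ih k (by omega) (L + 1) (by omega) with h3 | h3 | h3 <;> rw [h1, h2, h3] <;> simp
    intro L hL
    by_cases h1 : L < 2 * n
    · exact main L h1
    · by_cases h2 : L = 2 * n
      · rw [h2, h.hankelDet_two_mul hn]
        exact main 0 (by omega)
      · rw [show L = 2 * n + 1 by omega, h.hankelDet_two_mul_add_one hn]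
        exact main 1 (by omega)

theorem hankelDet_zero_add (h : IsMetallic n F V) (hn : 1 ≤ n) (s : ℕ) (hs : s ≤ 2 * n + 1) :
    ∀ j, hankelDet (fun i => coeff i (X ^ n * F)) 0 (j + s * (n + 1)) =
      (∏ i ∈ Finset.range s, hankelDet (fun i => coeff i (X ^ n * F)) i (n + 1)) *
        (-1) ^ (s * j + (n + 1) * s.choose 2) *
        hankelDet (fun i => coeff i (X ^ n * F)) s j := by
  induction s with
  | zero => simp
  | succ s ih =>
    intro j
    rw [show j + (s + 1) * (n + 1) = n + 1 + j + s * (n + 1) by ring, ih (by omega),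
      h.hankelDet_step hn (by omega), Finset.prod_range_succ, Nat.choose_succ_succ' s 1,
      Nat.choose_one_right]
    ring

theorem prod_hankelDet (h : IsMetallic n F V) :
    ∏ i ∈ Finset.range (2 * n), hankelDet (fun i => coeff i (X ^ n * F)) i (n + 1) = (-1) ^ n := by
  rw [two_mul, Finset.prod_range_add, ← Finset.prod_mul_distrib]
  have : ∀ i ∈ Finset.range n, hankelDet (fun i => coeff i (X ^ n * F)) i (n + 1) *
      hankelDet (fun i => coeff i (X ^ n * F)) (n + i) (n + 1) = (-1) ^ n := by
    intro i hi
    obtain ⟨h1, h2⟩ := h.hankelDet_sq_and_eq (Finset.mem_range.mp hi)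
    rw [h2, mul_assoc, ← sq, h1, mul_one]
  rw [Finset.prod_congr rfl this, Finset.prod_const, Finset.card_range, ← pow_mul]
  rcases Nat.even_or_odd n with hn | hn
  · rw [(hn.mul_left n).neg_one_pow, hn.neg_one_pow]
  · rw [(hn.mul hn).neg_one_pow, hn.neg_one_pow]

theorem hankelDet_add_period (h : IsMetallic n F V) (hn : 1 ≤ n) {L : ℕ} (hL : L ≤ 2 * n + 1)
    (j : ℕ) :
    hankelDet (fun i => coeff i (X ^ n * F)) L (j + 2 * n * (n + 1)) =
      (-1) ^ n * hankelDet (fun i => coeff i (X ^ n * F)) L j := by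
  have hzero : ∀ j, hankelDet (fun i => coeff i (X ^ n * F)) 0 (j + 2 * n * (n + 1)) =
      (-1) ^ n * hankelDet (fun i => coeff i (X ^ n * F)) 0 j := by
    intro j
    have hev : Even (2 * n * j + (n + 1) * (2 * n).choose 2) := by
      have hc : (2 * n).choose 2 = n * (2 * n - 1) := by
        rw [Nat.choose_two_right, mul_assoc, Nat.mul_div_cancel_left _ two_pos]
      rw [hc, ← mul_assoc (n + 1)]
      refine ((even_two_mul n).mul_right j).add (Even.mul_right ?_ _)
      rw [mul_comm]
      exact Nat.even_mul_succ_self n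
    rw [h.hankelDet_zero_add hn (2 * n) (by omega), h.prod_hankelDet, hev.neg_one_pow, mul_one,
      h.hankelDet_two_mul hn]
  -- H_L(j) is a unit multiple of H_0(j + L(n+1)), and adding the even number 2n(n+1) to j does not
  -- change the sign involved.
  have h1 := h.hankelDet_zero_add hn L hL (j + 2 * n * (n + 1))
  have h2 := h.hankelDet_zero_add hn L hL j
  rw [show j + 2 * n * (n + 1) + L * (n + 1) = j + L * (n + 1) + 2 * n * (n + 1) by ring, hzero,
    h2, show L * (j + 2 * n * (n + 1)) + (n + 1) * L.choose 2 =
      L * j + (n + 1) * L.choose 2 + 2 * (L * n * (n + 1)) by ring, pow_add _ _ (2 * _),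
    (even_two_mul _).neg_one_pow, mul_one, mul_left_comm] at h1
  refine (mul_left_cancel₀ (mul_ne_zero (Finset.prod_ne_zero_iff.mpr fun i hi => ?_)
    (pow_ne_zero _ (by norm_num))) h1).symm
  intro h0
  have hsq := h.hankelDet_succ_sq hn (L := i) (by rw [Finset.mem_range] at hi; omega)
  rw [h0] at hsq
  norm_num at hsq

end PowerSeries.IsMetallic

/-! ### Convergence of the continued fraction. -/

open WithZero MonoidWithZeroHom.ValueGroup₀ in
theorem LaurentSeries.tendsto_of_coeff_eventually_eq {K : Type*} [Field K] {u : ℕ → K⸨X⸩}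
    {x : K⸨X⸩} (h : ∀ D : ℤ, ∀ᶠ k in atTop, ∀ m < D, (u k - x).coeff m = 0) :
    Tendsto u atTop (𝓝 x) := by
  intro U hU
  obtain ⟨γ, hγ⟩ := Valued.mem_nhds.mp hU
  have hlt : exp (-(-(log (embedding γ.1) - 1))) < embedding γ.1 := by
    rw [← lt_log_iff_exp_lt (by simp)]
    simp
  rw [Filter.mem_map]
  filter_upwards [h (-(log (embedding γ.1) - 1))] with k hk
  refine hγ ?_
  change Valued.v.restrict (u k - x) < γ.1
  rw [Valuation.restrict_lt_iff_lt_embedding]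
  exact lt_of_le_of_lt ((LaurentSeries.valuation_le_iff_coeff_lt_eq_zero K).mpr hk) hlt

/-- The embedding of `ℤ⟦X⟧` into `ℚ((q))`. -/
noncomputable def intPowerSeriesHom : ℤ⟦X⟧ →+* ℚ⸨X⸩ :=
  (HahnSeries.ofPowerSeries ℤ ℚ).comp (PowerSeries.map (Int.castRingHom ℚ))

theorem intPowerSeriesHom_X : intPowerSeriesHom PowerSeries.X = qVar := by
  simp [intPowerSeriesHom, qVar]

theorem coeff_intPowerSeriesHom (f : ℤ⟦X⟧) (i : ℤ) :
    (intPowerSeriesHom f).coeff i = if i < 0 then 0 else ((PowerSeries.coeff i.natAbs f : ℤ) : ℚ) := by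
  have := PowerSeries.coeff_coe (PowerSeries.map (Int.castRingHom ℚ) f) i
  rw [PowerSeries.coeff_map] at this
  exact this

theorem qVar_ne_zero : qVar ≠ 0 := HahnSeries.single_ne_zero one_ne_zero

theorem intPowerSeriesHom_qInt (n : ℕ) :
    intPowerSeriesHom (qInt PowerSeries.X n) = qInt qVar n := by
  simp [qInt, intPowerSeriesHom_X]

theorem qInt_inv_mul_pow {K : Type*} [Field K] {q : K} (hq : q ≠ 0) (n : ℕ) :
    qInt q⁻¹ n * q ^ n = q * qInt q n := by
  rw [qInt, qInt, ← Finset.sum_range_reflect, Finset.sum_mul, Finset.mul_sum]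
  refine Finset.sum_congr rfl fun i hi => ?_
  rw [Finset.mem_range] at hi
  obtain ⟨k, rfl⟩ := Nat.exists_eq_add_of_lt hi
  rw [show i + k + 1 - 1 - i = k by omega, inv_pow]
  field_simp
  ring

theorem metallicCF_get? (n i : ℕ) : (metallicCF n).s.get? i =
    some (if Even i then ⟨qVar ^ n, qInt qVar⁻¹ n⟩ else ⟨qVar⁻¹ ^ n, qInt qVar n⟩) := rfl

open PowerSeries in
/-- The convergents of `metallicCF n`, with explicit errors. -/
theorem exists_metallicCF_nums_dens {n : ℕ} (hn : 1 ≤ n) {F V : ℤ⟦X⟧} (h : IsMetallic n F V)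
    {x μ : ℤ⟦X⟧} (hx : x = qInt X n - F) (hμ : μ = X * qInt X n * x + X ^ (2 * n)) (k : ℕ) :
    ∃ α β γ δ : ℤ⟦X⟧,
      (metallicCF n).nums (2 * k) * qVar ^ (k * n) = intPowerSeriesHom α ∧
      (metallicCF n).nums (2 * k + 1) * qVar ^ ((k + 1) * n) = intPowerSeriesHom δ ∧
      (metallicCF n).dens (2 * k) * qVar ^ (k * n) = intPowerSeriesHom β ∧
      (metallicCF n).dens (2 * k + 1) * qVar ^ ((k + 1) * n) = intPowerSeriesHom (X * γ) ∧
      constantCoeff β = 1 ∧ constantCoeff γ = 1 ∧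
      α - F * β = x * μ ^ k ∧ δ - F * (X * γ) = μ ^ (k + 1) := by
  have hn0 : n ≠ 0 := by omega
  -- x is the error of the zeroth convergent and μ the factor gained over one period; this relation
  -- makes the errors a geometric progression.
  have hμF : μ * F = -x := by
    rw [hμ, hx]
    linear_combination X ^ (2 * n) * (- h.tail_mul) + (1 + X * qInt X n * F) * (- h.eq_add)
  have ha : constantCoeff (qInt X n : ℤ⟦X⟧) = 1 := by
    rw [← coeff_zero_eq_constantCoeff_apply, coeff_qInt_X, if_pos (by omega)]
  have hb := qInt_inv_mul_pow qVar_ne_zero n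
  have hinv : qVar⁻¹ ^ n * qVar ^ n = 1 := by
    rw [← mul_pow, inv_mul_cancel₀ qVar_ne_zero, one_pow]
  induction k with
  | zero =>
    have hs := metallicCF_get? n 0
    rw [if_pos Even.zero] at hs
    refine ⟨qInt X n, 1, qInt X n, X * qInt X n ^ 2 + X ^ (2 * n), ?_, ?_, ?_, ?_, ?_, ha, ?_, ?_⟩
    · simp [metallicCF, intPowerSeriesHom_qInt]
    · rw [mul_zero, zero_add, GenContFract.first_num_eq hs]
      simp only [map_add, map_mul, map_pow, intPowerSeriesHom_X, intPowerSeriesHom_qInt]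
      change (qInt qVar⁻¹ n * qInt qVar n + qVar ^ n) * _ = _
      linear_combination qInt qVar n * hb
    · simp
    · rw [mul_zero, zero_add, GenContFract.first_den_eq hs]
      simp only [map_mul, intPowerSeriesHom_X, intPowerSeriesHom_qInt]
      linear_combination hb
    · simp
    · rw [hx]; ring
    · rw [hμ, hx]; ring
  | succ k ih =>
    obtain ⟨α, β, γ, δ, hα, hδ, hβ, hγ, hβ1, hγ1, e1, e2⟩ := ih
    have hs1 := metallicCF_get? n (2 * k + 1)
    rw [if_neg (by simp)] at hs1
    have hs2 := metallicCF_get? n (2 * k + 1 + 1)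
    rw [if_pos ⟨k + 1, by ring⟩] at hs2
    have hα' : (metallicCF n).nums (2 * k + 2) * qVar ^ ((k + 1) * n) =
        intPowerSeriesHom (qInt X n * δ + α) := by
      rw [GenContFract.nums_recurrence hs1 rfl rfl]
      simp only [map_add, map_mul, intPowerSeriesHom_qInt, ← hα, ← hδ]
      linear_combination (metallicCF n).nums (2 * k) * qVar ^ (k * n) * hinv
    have hβ' : (metallicCF n).dens (2 * k + 2) * qVar ^ ((k + 1) * n) =
        intPowerSeriesHom (qInt X n * (X * γ) + β) := by
      rw [GenContFract.dens_recurrence hs1 rfl rfl, map_add, map_mul _ (qInt X n), ← hγ, ← hβ,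
        intPowerSeriesHom_qInt]
      linear_combination (metallicCF n).dens (2 * k) * qVar ^ (k * n) * hinv
    have e1' : qInt X n * δ + α - F * (qInt X n * (X * γ) + β) = x * μ ^ (k + 1) := by
      linear_combination qInt X n * e2 + e1 + μ ^ k * hμF - μ ^ (k + 1) * hx
    refine ⟨qInt X n * δ + α, qInt X n * (X * γ) + β,
      qInt X n * (qInt X n * (X * γ) + β) + X ^ (2 * n) * γ,
      X * qInt X n * (qInt X n * δ + α) + X ^ (2 * n) * δ, hα', ?_, hβ', ?_, ?_, ?_, e1', ?_⟩
    · rw [show 2 * (k + 1) + 1 = 2 * k + 1 + 2 by ring, GenContFract.nums_recurrence hs2 rfl rfl,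
        map_add, map_mul _ (X * qInt X n), map_mul _ (X ^ (2 * n)), ← hα', ← hδ]
      simp only [map_mul, map_pow, intPowerSeriesHom_X, intPowerSeriesHom_qInt]
      linear_combination (metallicCF n).nums (2 * k + 2) * qVar ^ ((k + 1) * n) * hb
    · rw [show 2 * (k + 1) + 1 = 2 * k + 1 + 2 by ring, GenContFract.dens_recurrence hs2 rfl rfl,
        show X * (qInt X n * (qInt X n * (X * γ) + β) + X ^ (2 * n) * γ) =
          X * qInt X n * (qInt X n * (X * γ) + β) + X ^ (2 * n) * (X * γ) by ring,
        map_add, map_mul _ (X * qInt X n), map_mul _ (X ^ (2 * n)), ← hβ', ← hγ]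
      simp only [map_mul, map_pow, intPowerSeriesHom_X, intPowerSeriesHom_qInt]
      linear_combination (metallicCF n).dens (2 * k + 2) * qVar ^ ((k + 1) * n) * hb
    · simp [hβ1]
    · simp [hβ1, ha, hn0]
    · linear_combination X * qInt X n * e1' + X ^ (2 * n) * e2 - μ ^ (k + 1) * hμ

open PowerSeries in
theorem metallicCF_convs_sub {n : ℕ} (hn : 1 ≤ n) {F V : ℤ⟦X⟧} (h : IsMetallic n F V) (k : ℕ) :
    ∃ w : ℤ⟦X⟧, (metallicCF n).convs k - intPowerSeriesHom F =
      intPowerSeriesHom (X ^ (k / 2) * w) := by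
  have hX : intPowerSeriesHom X ≠ 0 := by
    rw [intPowerSeriesHom_X]
    exact qVar_ne_zero
  -- μ = X y. The odd denominators X γ cost one factor X, absorbed by the extra factor μ in the odd
  -- errors.
  obtain ⟨y, hy⟩ : ∃ y : ℤ⟦X⟧, X * qInt X n * (qInt X n - F) + X ^ (2 * n) = X * y :=
    ⟨qInt X n * (qInt X n - F) + X ^ (2 * n - 1), by
      rw [mul_add, ← pow_succ', Nat.sub_add_cancel (by omega)]; ring⟩
  obtain ⟨α, β, γ, δ, hα, hδ, hβ, hγ, hβ1, hγ1, e1, e2⟩ :=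
    exists_metallicCF_nums_dens hn h rfl hy.symm (k / 2)
  have hunit : ∀ f : ℤ⟦X⟧, constantCoeff f = 1 → ∃ g, f * g = 1 ∧ intPowerSeriesHom f ≠ 0 := by
    intro f hf
    have := mul_invOfUnit f 1 (by simp [hf])
    refine ⟨_, this, fun h0 => ?_⟩
    have h1 := congrArg intPowerSeriesHom this
    rw [map_mul, h0, zero_mul, map_one] at h1
    exact zero_ne_one h1
  have hq : ∀ m, qVar ^ m ≠ 0 := fun m => pow_ne_zero m qVar_ne_zero
  rcases Nat.even_or_odd' k with ⟨m, rfl | rfl⟩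
  · rw [Nat.mul_div_cancel_left _ two_pos] at *
    obtain ⟨g, hg, hne⟩ := hunit β hβ1
    refine ⟨(qInt X n - F) * y ^ m * g, ?_⟩
    rw [GenContFract.conv_eq_num_div_den, ← mul_div_mul_right _ _ (hq (m * n)), hα, hβ,
      div_sub' hne, div_eq_iff hne, ← map_mul, ← map_mul, ← map_sub]
    congr 1
    rw [mul_pow] at e1
    linear_combination e1 - (qInt X n - F) * X ^ m * y ^ m * hg
  · rw [show (2 * m + 1) / 2 = m by omega] at *
    obtain ⟨g, hg, hne⟩ := hunit γ hγ1
    have hne' : intPowerSeriesHom (X * γ) ≠ 0 := by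
      rw [map_mul]
      exact mul_ne_zero hX hne
    refine ⟨y ^ (m + 1) * g, ?_⟩
    rw [GenContFract.conv_eq_num_div_den, ← mul_div_mul_right _ _ (hq ((m + 1) * n)), hδ, hγ,
      div_sub' hne', div_eq_iff hne', ← map_mul, ← map_mul, ← map_sub]
    congr 1
    rw [mul_pow] at e2
    linear_combination e2 - X ^ (m + 1) * y ^ (m + 1) * hg

open PowerSeries in
theorem metallicCF_tendsto {n : ℕ} (hn : 1 ≤ n) {F V : ℤ⟦X⟧} (h : IsMetallic n F V) :
    Tendsto (metallicCF n).convs atTop (𝓝 (intPowerSeriesHom F)) := by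
  refine LaurentSeries.tendsto_of_coeff_eventually_eq fun D => ?_
  filter_upwards [eventually_ge_atTop (2 * D.toNat)] with k hk m hm
  obtain ⟨w, hw⟩ := metallicCF_convs_sub hn h k
  change ((metallicCF n).convs k - intPowerSeriesHom F).coeff m = 0
  rw [hw, coeff_intPowerSeriesHom, coeff_X_pow_mul']
  split_ifs
  · rfl
  · omega
  · simp

theorem hankelDet_intCast (f : ℕ → ℤ) (ℓ j : ℕ) :
    hankelDet (fun i => (f i : ℚ)) ℓ j = ((hankelDet f ℓ j : ℤ) : ℚ) := by
  exact (RingHom.map_det (Int.castRingHom ℚ) _).symm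

theorem mainTheorem2 (n : ℕ) (hn : 1 ≤ n) :
    -- the continued fraction converges, and its limit is a power series over the integers
    Tendsto (metallicCF n).convs atTop (𝓝 (qMetallic n)) ∧
    (∃ F : ℤ⟦X⟧, qMetallic n =
      HahnSeries.ofPowerSeries ℤ ℚ (PowerSeries.map (Int.castRingHom ℚ) F)) ∧
    -- values and periodicity of the Hankel determinants
    ∀ ℓ : ℕ, ℓ ≤ n + 1 →
      (∀ j : ℕ, metallicHankel n ℓ j = -1 ∨ metallicHankel n ℓ j = 0 ∨
        metallicHankel n ℓ j = 1) ∧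
      (∀ j : ℕ, metallicHankel n ℓ (j + 2 * n * (n + 1)) =
        (-1) ^ n * metallicHankel n ℓ j) ∧
      (Even n → Function.Periodic (metallicHankel n ℓ) (2 * n * (n + 1))) ∧
      (Odd n → Function.Antiperiodic (metallicHankel n ℓ) (2 * n * (n + 1)) ∧
        Function.Periodic (metallicHankel n ℓ) (4 * n * (n + 1))) := by
  obtain ⟨F, V, h⟩ := PowerSeries.exists_isMetallic hn
  have hlim := metallicCF_tendsto hn h
  have hΦ : qMetallic n = intPowerSeriesHom F := hlim.limUnder_eq
  refine ⟨hΦ ▸ hlim, ⟨F, hΦ⟩, fun ℓ hℓ => ?_⟩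
  -- Padding by q^n turns shift ℓ into n + ℓ, so ℓ ≤ n + 1 is exactly the range n + ℓ ≤ 2n + 1 of
  -- the cycle.
  have hH : ∀ j, metallicHankel n ℓ j =
      ((hankelDet (fun i => PowerSeries.coeff i (PowerSeries.X ^ n * F)) (n + ℓ) j : ℤ) : ℚ) := by
    intro j
    rw [← hankelDet_intCast, metallicHankel, hΦ, hankelDet, hankelDet]
    congr 1
    ext a b
    simp only [Matrix.of_apply]
    rw [coeff_intPowerSeriesHom, if_neg (by omega), Int.natAbs_natCast,
      show n + ℓ + a + b = ℓ + a + b + n by ring, PowerSeries.coeff_X_pow_mul]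
  have hper : ∀ j : ℕ, metallicHankel n ℓ (j + 2 * n * (n + 1)) =
      (-1) ^ n * metallicHankel n ℓ j := by
    intro j
    rw [hH, hH, h.hankelDet_add_period hn (by omega)]
    push_cast
    rfl
  refine ⟨fun j => ?_, hper, fun he j => ?_, fun ho => ?_⟩
  · rw [hH]
    rcases h.hankelDet_mem hn j (n + ℓ) (by omega) with h1 | h1 | h1 <;> rw [h1] <;> simp
  · rw [hper, he.neg_one_pow, one_mul]
  · have hanti : Function.Antiperiodic (metallicHankel n ℓ) (2 * n * (n + 1)) := by
      intro j
      rw [hper, ho.neg_one_pow, neg_one_mul]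
    refine ⟨hanti, fun j => ?_⟩
    rw [show j + 4 * n * (n + 1) = j + 2 * n * (n + 1) + 2 * n * (n + 1) by ring, hanti, hanti,
      neg_neg]
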